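/- For $a_1,\dots,a_n\in\mathbb R^m$ let $\mathrm{cone}\{a_1,\dots,a_n\}=\{\sum_i\lambda_i a_i : \lambda_i\ge 0\}$. Let $\|\cdot\|$ be the Euclidean norm, and for $x\in\mathrm{cone}\{a_1,\dots,a_n\}$ let $\|x\|_A=\min\{\sum_i\lambda_i : \lambda\ge 0,\ x=\sum_i\lambda_i a_i\}$. Put $$\mu_A=\max\{\|x\|_A : x\in\mathrm{cone}\{a_1,\dots,a_n\},\ \|x\|\le 1\}.$$ A random projection $T:\mathbb R^m\to\mathbb R^k$ is a random linear map $T(x)=s\,Px$, where $s>0$ is a fixed normalising scalar (for instance $s=\sqrt{1/k}$) and $P$ is a random $k\times m$ matrix of one of the following four kinds: 1. the orthogonal projection on a uniformly distributed (rotation-invariant) random $k$-dimensional linear subspace of $\mathbb R^m$, the subspace being identified with $\mathbb R^k$ by an orthonormal basis; 2. a matrix with independent standard normal entries; 3. a matrix with independent entries equal to $+1$ or $-1$ with probability $\frac12$ each; 4. a matrix with independent entries equal to $+1,0,-1$ with probabilities $\frac16,\frac23,\frac16$. **Theorem.** There is a universal constant $\mathcal C>0$ (in particular independent of $m,n,k,d$)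 such that the following holds for all $m,k$ and all $n\ge 1$. Let $b,a_1,\dots,a_n\in\mathbb R^m$ be vectors of norm $1$ with $b\notin C=\mathrm{cone}\{a_1,\dots,a_n\}$, let $d=\min_{x\in C}\|b-x\|$, let $p$ be the projection of $b$ onto $C$ (the point of $C$ nearest to $b$), and let $$\varepsilon=\frac{d^2}{\mu_A^2+2\|p\|\mu_A+1}.$$ Then for every random projection $T:\mathbb R^m\to\mathbb R^k$ as above, $$\mathrm{Prob}\bigl(T(b)\notin\mathrm{cone}\{T(a_1),\dots,T(a_n)\}\bigr)\ \ge\ 1-2n(n+1)e^{-\mathcal C(\varepsilon^2-\varepsilon^3)k}.$$ -/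

import Mathlib

open MeasureTheory ProbabilityTheory
open scoped Matrix

noncomputable section

namespace RandProjCone

/-- The cone of all nonnegative linear combinations of `a 0, …, a (n - 1)`. -/
def cone {E : Type*} [AddCommGroup E] [Module ℝ E] {n : ℕ} (a : Fin n → E) : Set E :=
  {x | ∃ l : Fin n → ℝ, (∀ i, 0 ≤ l i) ∧ x = ∑ i, l i • a i}

/-- The explicit cone is the pointed cone spanned by the vectors in the sense of Mathlib. -/
theorem cone_eq_hull {E : Type*} [AddCommGroup E] [Module ℝ E] {n : ℕ} (a : Fin n → E) :
    cone a = (PointedCone.hull ℝ (Set.range a) : Set E) := by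
  ext x
  rw [SetLike.mem_coe, PointedCone.hull, Submodule.mem_span_range_iff_exists_fun]
  constructor
  · rintro ⟨l, hl, rfl⟩
    exact ⟨fun i => ⟨l i, hl i⟩, rfl⟩
  · rintro ⟨l, rfl⟩
    exact ⟨fun i => l i, fun i => (l i).2, rfl⟩

/-- The `A`-norm of `x ∈ cone a`: the least total weight `∑ i, l i` of a representation
`x = ∑ i, l i • a i` with nonnegative weights. -/
def aNorm {E : Type*} [AddCommGroup E] [Module ℝ E] {n : ℕ} (a : Fin n → E) (x : E) : ℝ :=
  sInf {r | ∃ l : Fin n → ℝ, (∀ i, 0 ≤ l i) ∧ x = ∑ i, l i • a i ∧ r = ∑ i, l i}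

/-- The distortion constant `μ_A`: the largest `A`-norm of a vector of the cone whose Euclidean
norm is at most one. -/
def muA {m n : ℕ} (a : Fin n → EuclideanSpace ℝ (Fin m)) : ℝ :=
  sSup {r | ∃ x ∈ cone a, ‖x‖ ≤ 1 ∧ r = aNorm a x}

/-- `p` is a projection (a nearest point) of `b` on the set `S`. -/
def IsProjOn {E : Type*} [NormedAddCommGroup E] (S : Set E) (b p : E) : Prop :=
  p ∈ S ∧ ∀ x ∈ S, ‖b - p‖ ≤ ‖b - x‖

/-- The uniform distribution on `{1, -1}`. -/
def signLaw : Measure ℝ :=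
  (1 / 2 : ENNReal) • Measure.dirac 1 + (1 / 2 : ENNReal) • Measure.dirac (-1)

/-- The distribution taking the values `1, 0, -1` with probabilities `1/6, 2/3, 1/6`. -/
def sparseLaw : Measure ℝ :=
  (1 / 6 : ENNReal) • Measure.dirac 1 + (2 / 3 : ENNReal) • Measure.dirac 0 +
    (1 / 6 : ENNReal) • Measure.dirac (-1)

section RandomMatrix

variable {Ω : Type*} [MeasurableSpace Ω] {k m : ℕ}

/-- The entries of the random matrix `P` are independent with common distribution `ν`. -/
def HasIndepEntries (P : Ω → Matrix (Fin k) (Fin m) ℝ) (Pr : Measure Ω) (ν : Measure ℝ) : Prop :=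
  (∀ i j, HasLaw (fun ω => P ω i j) ν Pr) ∧
    iIndepFun (fun (ij : Fin k × Fin m) ω => P ω ij.1 ij.2) Pr

/-- `P` is the orthogonal projection of `ℝᵐ` on a uniformly distributed `k`-dimensional linear
subspace `V`, written as a `k × m` matrix in an orthonormal basis of `V`: the rows of `P` are
orthonormal, so `V` is their span and `Pᵀ P` is the matrix of the orthogonal projection on `V`;
and `V` is uniform, which means that the law of this projection is invariant under all
orthogonal transformations of `ℝᵐ`. The choice of the orthonormal basis of `V` is arbitrary. -/
def IsUniformProjection (P : Ω → Matrix (Fin k) (Fin m) ℝ) (Pr : Measure Ω) : Prop :=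
  (∀ i j, AEMeasurable (fun ω => P ω i j) Pr) ∧
    (∀ᵐ ω ∂Pr, P ω * (P ω)ᵀ = 1) ∧
    ∀ U ∈ Matrix.orthogonalGroup (Fin m) ℝ,
      IdentDistrib (fun ω i j => (U * ((P ω)ᵀ * P ω) * Uᵀ) i j)
        (fun ω i j => ((P ω)ᵀ * P ω) i j) Pr Pr

/-- The four families of random matrices: orthogonal projections on a random `k`-dimensional
subspace, and matrices with independent entries that are standard normal, uniform signs, or
`1, 0, -1` with probabilities `1/6, 2/3, 1/6`. -/
inductive IsRandomProjectionMatrix (P : Ω → Matrix (Fin k) (Fin m) ℝ) (Pr : Measure Ω) : Prop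
  | subspace (h : IsUniformProjection P Pr)
  | gaussian (h : HasIndepEntries P Pr (gaussianReal 0 1))
  | sign (h : HasIndepEntries P Pr signLaw)
  | sparse (h : HasIndepEntries P Pr sparseLaw)

end RandomMatrix

/-- The linear map `T x = s P x` from `ℝᵐ` to `ℝᵏ`. -/
def scaledMap {k m : ℕ} (s : ℝ) (P : Matrix (Fin k) (Fin m) ℝ) :
    EuclideanSpace ℝ (Fin m) →ₗ[ℝ] EuclideanSpace ℝ (Fin k) :=
  s • Matrix.toEuclideanLin P

end RandProjCone

end

/-! Suppose `T` preserves, up to an error `δ * N`, all inner products among `b` and the generators,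
after rescaling by a common factor `N`. If `T b` lay in the image cone, then `T b = T x` for some
`x` in the cone. For every representation of `x` with total weight `L`, bilinear expansion gives
`N‖b - x‖² - δN(1 + L)² ≤ ‖T(b - x)‖² = 0`. Taking the infimum over representations yields `‖b - x‖²
≤ δ(1 + μ_A‖x‖)²`. Pythagoras and Cauchy–Schwarz forbid this when `δ < ε` (`IsProjOn.mul_sq_lt`,
`map_notMem_cone`).

The rest is probabilistic. By polarization it suffices that `P` almost preserves the norms of sums
and differences of the vectors, and a union bound reduces this to one unit vector
(`NormConcentration`). For independent entries, `‖P x‖²` is a sum of `k` independent squares of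
sub-Gaussian variables, so a Chernoff bound applies (`measureReal_sum_sq_le`). For a uniform
subspace, rotation invariance and Fubini replace the fixed vector by a Gaussian one and the random
projection by a fixed one (`IsUniformProjection.normConcentration`). -/

namespace RandProjCone

/-! ### Finitely generated cones and weights of representations -/

section Cone

variable {E : Type*} [NormedAddCommGroup E] [NormedSpace ℝ E] {n : ℕ}

/-- Conic Carathéodory theorem. -/
theorem exists_rep_linearIndependent (a : Fin n → E) {x : E} (hx : x ∈ cone a) :
    ∃ S : Finset (Fin n), LinearIndependent ℝ (fun i : S => a i) ∧
      ∃ l : Fin n → ℝ, (∀ i, 0 ≤ l i) ∧ (∀ i ∉ S, l i = 0) ∧ x = ∑ i, l i • a i := by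
  classical
  let R : Set (Fin n → ℝ) := {l | (∀ i, 0 ≤ l i) ∧ x = ∑ i, l i • a i}
  let supp : (Fin n → ℝ) → Finset (Fin n) := fun l => Finset.univ.filter fun i => l i ≠ 0
  have hR : R.Nonempty := hx
  obtain ⟨l, hl, hmin⟩ := exists_minimalFor_of_wellFoundedLT (fun l => l ∈ R)
    (fun l => (supp l).card) hR
  refine ⟨supp l, ?_, l, hl.1, fun i hi => by simpa [supp] using hi, hl.2⟩
  by_contra hdep
  rw [Fintype.not_linearIndependent_iff] at hdep
  obtain ⟨g₀, hg₀, j₀, hj₀⟩ := hdep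
  -- Extend the dependency by zero and choose its sign so that some coefficient is positive.
  obtain ⟨g, hgsupp, hg, j, hj⟩ : ∃ g : Fin n → ℝ, (∀ i, l i = 0 → g i = 0) ∧
      ∑ i, g i • a i = 0 ∧ ∃ j, 0 < g j := by
    let g₁ : Fin n → ℝ := fun i => if h : i ∈ supp l then g₀ ⟨i, h⟩ else 0
    have h1 : ∀ i, l i = 0 → g₁ i = 0 := fun i hi => by simp [g₁, supp, hi]
    have h2 : ∑ i, g₁ i • a i = 0 := by
      have h : ∀ i : supp l, g₀ i • a i = g₁ i • a i := fun i => by simp [g₁]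
      rw [← hg₀, Finset.sum_congr rfl fun i _ => h i,
        Finset.sum_coe_sort (supp l) (fun i => g₁ i • a i)]
      refine (Finset.sum_subset (Finset.subset_univ _) fun i _ hi => ?_).symm
      rw [h1 i (by simpa [supp] using hi), zero_smul]
    have h3 : g₁ j₀ ≠ 0 := by simpa [g₁] using hj₀
    rcases lt_or_gt_of_ne h3 with h | h
    · exact ⟨-g₁, fun i hi => by simp [h1 i hi], by simp [h2], j₀, by simpa using h⟩
    · exact ⟨g₁, h1, h2, j₀, h⟩
  obtain ⟨i₀, hi₀, hle⟩ := Finset.exists_min_image (Finset.univ.filter fun i => 0 < g i)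
    (fun i => l i / g i) ⟨j, by simpa using hj⟩
  have hgi : 0 < g i₀ := by simpa using hi₀
  -- The largest step along `-g` that keeps all weights nonnegative; it kills the weight at `i₀`,
  -- contradicting minimal support.
  set r := l i₀ / g i₀ with hr
  have hr0 : 0 ≤ r := div_nonneg (hl.1 _) hgi.le
  have hmem : l - r • g ∈ R := by
    refine ⟨fun i => ?_, ?_⟩
    · simp only [Pi.sub_apply, Pi.smul_apply, smul_eq_mul, sub_nonneg]
      rcases lt_or_ge 0 (g i) with h | h
      · exact (le_div_iff₀ h).1 (hle i (by simpa using h))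
      · exact (mul_nonpos_of_nonneg_of_nonpos hr0 h).trans (hl.1 i)
    · simp only [Pi.sub_apply, Pi.smul_apply, sub_smul, Finset.sum_sub_distrib, smul_assoc,
        ← Finset.smul_sum, hg, smul_zero, sub_zero]
      exact hl.2
  have hlt : (supp (l - r • g)).card < (supp l).card := by
    apply Finset.card_lt_card
    rw [Finset.ssubset_iff_of_subset]
    · refine ⟨i₀, ?_, ?_⟩
      · simp only [supp, Finset.mem_filter, Finset.mem_univ, true_and]
        exact fun h => hgi.ne' (hgsupp _ h)
      · simp [supp, hr, hgi.ne']
    · intro i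
      simp only [supp, Finset.mem_filter, Finset.mem_univ, true_and, Pi.sub_apply, Pi.smul_apply]
      intro h h0
      exact h (by simp [h0, hgsupp i h0])
  exact absurd (hmin hmem hlt.le) (not_le.2 hlt)

/-- Every point of a finitely generated cone has a representation whose total weight is
bounded by a fixed multiple of the norm. -/
theorem exists_rep_sum_le (a : Fin n → E) :
    ∃ M : ℝ, 0 ≤ M ∧ ∀ x ∈ cone a, ∃ l : Fin n → ℝ, (∀ i, 0 ≤ l i) ∧ x = ∑ i, l i • a i ∧
      ∑ i, l i ≤ M * ‖x‖ := by
  classical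
  -- On an independent subfamily the coefficient map is injective on a finite-dimensional space,
  -- hence bounded below. Only finitely many subfamilies occur, so their constants can be summed.
  have key : ∀ S : Finset (Fin n), ∃ K : ℝ, 0 ≤ K ∧
      (LinearIndependent ℝ (fun i : S => a i) → ∀ l : Fin n → ℝ, (∀ i ∉ S, l i = 0) →
        ∀ i, l i ≤ K * ‖∑ i, l i • a i‖) := by
    intro S
    by_cases hS : LinearIndependent ℝ (fun i : S => a i)
    · obtain ⟨K, -, hK⟩ := (Fintype.linearCombination ℝ (fun i : S => a i)).exists_antilipschitzWith
        (LinearMap.ker_eq_bot.2 (linearIndependent_iff_injective_fintypeLinearCombination.1 hS))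
      refine ⟨K, K.2, fun _ l hl i => ?_⟩
      have h := hK.le_mul_dist (fun i : S => l i) 0
      rw [map_zero, dist_zero_right, dist_zero_right] at h
      have hsum : Fintype.linearCombination ℝ (fun i : S => a i) (fun i : S => l i) =
          ∑ i, l i • a i := by
        rw [Fintype.linearCombination_apply, Finset.sum_coe_sort S (fun i => l i • a i)]
        exact Finset.sum_subset (Finset.subset_univ _) fun i _ hi => by simp [hl i hi]
      rw [hsum] at h
      by_cases hi : i ∈ S
      · exact (le_abs_self _).trans ((norm_le_pi_norm (fun i : S => l i) ⟨i, hi⟩).trans h)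
      · rw [hl i hi]; positivity
    · exact ⟨0, le_rfl, fun h => absurd h hS⟩
  choose K hK0 hK using key
  refine ⟨∑ _i : Fin n, ∑ S, K S,
    Finset.sum_nonneg fun _ _ => Finset.sum_nonneg fun S _ => hK0 S, fun x hx => ?_⟩
  obtain ⟨S, hS, l, hl, hlS, rfl⟩ := exists_rep_linearIndependent a hx
  refine ⟨l, hl, rfl, ?_⟩
  rw [Finset.sum_mul]
  refine Finset.sum_le_sum fun i _ => (hK S hS l hlS i).trans ?_
  gcongr
  exact Finset.single_le_sum (f := K) (fun S _ => hK0 S) (Finset.mem_univ S)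

theorem zero_mem_cone (a : Fin n → E) : (0 : E) ∈ cone a :=
  ⟨0, fun _ => le_rfl, by simp⟩

theorem smul_mem_cone {a : Fin n → E} {x : E} (hx : x ∈ cone a) {r : ℝ} (hr : 0 ≤ r) :
    r • x ∈ cone a := by
  obtain ⟨l, hl, rfl⟩ := hx
  exact ⟨r • l, fun i => mul_nonneg hr (hl i), by simp [Finset.smul_sum, smul_smul]⟩

theorem convex_cone (a : Fin n → E) : Convex ℝ (cone a) := by
  rw [cone_eq_hull]
  exact (PointedCone.hull ℝ (Set.range a)).toConvexCone.convex

theorem aNorm_le_of_rep {a : Fin n → E} {x : E} {l : Fin n → ℝ} (hl : ∀ i, 0 ≤ l i)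
    (hx : x = ∑ i, l i • a i) : aNorm a x ≤ ∑ i, l i :=
  csInf_le ⟨0, by rintro _ ⟨l, hl, -, rfl⟩; exact Finset.sum_nonneg fun i _ => hl i⟩ ⟨l, hl, hx, rfl⟩

theorem le_aNorm {a : Fin n → E} {x : E} (hx : x ∈ cone a) {r : ℝ}
    (h : ∀ l : Fin n → ℝ, (∀ i, 0 ≤ l i) → x = ∑ i, l i • a i → r ≤ ∑ i, l i) : r ≤ aNorm a x := by
  obtain ⟨l, hl, hx⟩ := hx
  refine le_csInf ⟨_, l, hl, hx, rfl⟩ ?_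
  rintro _ ⟨l, hl, hx, rfl⟩
  exact h l hl hx

end Cone

/-! ### The distortion constant and quantitative separation -/

section MuA

variable {m n : ℕ}

/-- The uniform weight bound makes the set defining `muA` bounded above, so its `sSup` is a genuine
supremum and not the default value `0`. -/
theorem aNorm_le_muA (a : Fin n → EuclideanSpace ℝ (Fin m)) {x : EuclideanSpace ℝ (Fin m)}
    (hx : x ∈ cone a) (h : ‖x‖ ≤ 1) : aNorm a x ≤ muA a := by
  obtain ⟨M, hM0, hM⟩ := exists_rep_sum_le a
  refine le_csSup ⟨M, ?_⟩ ⟨x, hx, h, rfl⟩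
  rintro _ ⟨y, hy, hy1, rfl⟩
  obtain ⟨l, hl, hyl, hle⟩ := hM y hy
  exact (aNorm_le_of_rep hl hyl).trans (hle.trans (mul_le_of_le_one_right hM0 hy1))

theorem muA_nonneg (a : Fin n → EuclideanSpace ℝ (Fin m)) : 0 ≤ muA a :=
  (le_aNorm (zero_mem_cone a) fun _ hl _ => Finset.sum_nonneg fun i _ => hl i).trans
    (aNorm_le_muA a (zero_mem_cone a) (by simp))

/-- Homogeneity: each representation of `x / ‖x‖` rescales to one of `x`. -/
theorem aNorm_le_muA_mul_norm (a : Fin n → EuclideanSpace ℝ (Fin m))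
    {x : EuclideanSpace ℝ (Fin m)} (hx : x ∈ cone a) : aNorm a x ≤ muA a * ‖x‖ := by
  rcases eq_or_ne x 0 with rfl | h0
  · simpa using aNorm_le_of_rep (a := a) (l := 0) (x := 0) (fun _ => le_rfl) (by simp)
  have hpos : 0 < ‖x‖ := norm_pos_iff.2 h0
  have hy : ‖x‖⁻¹ • x ∈ cone a := smul_mem_cone hx (by positivity)
  have h1 := aNorm_le_muA a hy (by rw [norm_smul, norm_inv, norm_norm, inv_mul_cancel₀ hpos.ne'])
  rw [← div_le_iff₀ hpos]
  refine (le_aNorm hy fun l hl hyl => ?_).trans h1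
  rw [div_le_iff₀ hpos, mul_comm, Finset.mul_sum]
  refine aNorm_le_of_rep (fun i => mul_nonneg hpos.le (hl i)) ?_
  simp_rw [mul_smul]
  rw [← Finset.smul_sum, ← hyl, smul_smul, mul_inv_cancel₀ hpos.ne', one_smul]

theorem IsProjOn.inner_sub_nonpos {a : Fin n → EuclideanSpace ℝ (Fin m)}
    {b p x : EuclideanSpace ℝ (Fin m)} (hp : IsProjOn (cone a) b p) (hx : x ∈ cone a) :
    inner ℝ (b - p) (x - p) ≤ 0 := by
  refine (norm_eq_iInf_iff_real_inner_le_zero (convex_cone a) hp.1).1 ?_ x hx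
  have : Nonempty (cone a) := ⟨⟨p, hp.1⟩⟩
  refine le_antisymm (le_ciInf fun w => hp.2 w w.2) ?_
  exact ciInf_le ⟨0, by rintro _ ⟨w, rfl⟩; positivity⟩ (⟨p, hp.1⟩ : cone a)

theorem IsProjOn.inner_eq_zero {a : Fin n → EuclideanSpace ℝ (Fin m)}
    {b p : EuclideanSpace ℝ (Fin m)} (hp : IsProjOn (cone a) b p) : inner ℝ (b - p) p = 0 := by
  have h0 := hp.inner_sub_nonpos (zero_mem_cone a)
  -- Testing against `0` and `2p` moves from `p` in both directions along its ray, which forces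
  -- equality.
  have h2 := hp.inner_sub_nonpos (smul_mem_cone hp.1 (zero_le_two (α := ℝ)))
  rw [two_smul, add_sub_cancel_right] at h2
  rw [zero_sub, inner_neg_right] at h0
  linarith

theorem IsProjOn.infDist_eq {E : Type*} [NormedAddCommGroup E] {S : Set E} {b p : E}
    (hp : IsProjOn S b p) : Metric.infDist b S = ‖b - p‖ := by
  refine le_antisymm ((Metric.infDist_le_dist_of_mem hp.1).trans_eq (dist_eq_norm _ _)) ?_
  exact (Metric.le_infDist ⟨p, hp.1⟩).2 fun {y} hy => (hp.2 y hy).trans_eq (dist_eq_norm _ _).symm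

/-- The quantitative separation of `b` from the points of the cone. -/
theorem IsProjOn.mul_sq_lt {a : Fin n → EuclideanSpace ℝ (Fin m)}
    {b p : EuclideanSpace ℝ (Fin m)} (hp : IsProjOn (cone a) b p) (hb : ‖b‖ = 1)
    (hbC : b ∉ cone a) {δ : ℝ} (hδ0 : 0 ≤ δ)
    (hδ : δ < ‖b - p‖ ^ 2 / (muA a ^ 2 + 2 * ‖p‖ * muA a + 1))
    {x : EuclideanSpace ℝ (Fin m)} (hx : x ∈ cone a) :
    δ * (1 + muA a * ‖x‖) ^ 2 < ‖b - x‖ ^ 2 := by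
  have hμ := muA_nonneg a
  have hd : 0 < ‖b - p‖ := norm_pos_iff.2 (sub_ne_zero.2 fun h => hbC (h ▸ hp.1))
  have hpyth : ‖b - p‖ ^ 2 + ‖p‖ ^ 2 = 1 := by
    have h := norm_add_sq_real (b - p) p
    rw [sub_add_cancel, hp.inner_eq_zero, hb] at h
    linarith
  have hbx : ‖b - p‖ ^ 2 + ‖x - p‖ ^ 2 ≤ ‖b - x‖ ^ 2 := by
    have h := norm_sub_sq_real (b - p) (x - p)
    rw [sub_sub_sub_cancel_right] at h
    linarith [hp.inner_sub_nonpos hx]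
  have hr : ‖x‖ ≤ ‖p‖ + ‖x - p‖ := by
    simpa using norm_add_le p (x - p)
  rw [lt_div_iff₀ (by positivity)] at hδ
  refine lt_of_lt_of_le ?_ hbx
  generalize ‖b - p‖ = d at *
  generalize ‖x - p‖ = q at *
  have hp0 := norm_nonneg p
  have hx0 := norm_nonneg x
  generalize ‖p‖ = t at *
  generalize ‖x‖ = r at *
  generalize muA a = μ at *
  have h1 : (1 + μ * r) ^ 2 ≤ (1 + μ * t + μ * q) ^ 2 := by
    have h := mul_le_mul_of_nonneg_left hr hμ
    exact pow_le_pow_left₀ (by positivity) (by linarith) 2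
  have hD : (1 + μ * t) ^ 2 + μ ^ 2 * d ^ 2 = μ ^ 2 + 2 * t * μ + 1 := by
    linear_combination μ ^ 2 * hpyth
  -- Cauchy–Schwarz for `(1 + μt, μd)` and `(d, q)`. By `d² + t² = 1` the first vector has squared
  -- length equal to the denominator of `ε`.
  have h2 : (1 + μ * t + μ * q) ^ 2 * d ^ 2 ≤ (μ ^ 2 + 2 * t * μ + 1) * (d ^ 2 + q ^ 2) := by
    rw [← hD]
    nlinarith [sq_nonneg ((1 + μ * t) * q - μ * d ^ 2)]
  have hd2 : 0 < d ^ 2 := by positivity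
  refine lt_of_mul_lt_mul_right ?_ hd2.le
  calc δ * (1 + μ * r) ^ 2 * d ^ 2 ≤ δ * ((1 + μ * t + μ * q) ^ 2 * d ^ 2) := by
        rw [mul_assoc]; gcongr
    _ ≤ δ * ((μ ^ 2 + 2 * t * μ + 1) * (d ^ 2 + q ^ 2)) := by gcongr
    _ = δ * (μ ^ 2 + 2 * t * μ + 1) * (d ^ 2 + q ^ 2) := by ring
    _ < d ^ 2 * (d ^ 2 + q ^ 2) := by gcongr
    _ = _ := by ring

end MuA

/-! ### Approximate preservation of inner products -/

section NearIsometry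

variable {E F : Type*} [NormedAddCommGroup E] [InnerProductSpace ℝ E] [NormedAddCommGroup F]
  [InnerProductSpace ℝ F]

/-- A linear map that almost preserves (up to the factor `N`) the norms of all normalised sums and
differences of two unit vectors almost preserves their inner product. -/
theorem abs_inner_map_sub_le (T : E →ₗ[ℝ] F) {N δ : ℝ} {x y : E} (hx : ‖x‖ = 1) (hy : ‖y‖ = 1)
    (h : ∀ z ∈ ({x + y, x - y} : Set E), |‖T z‖ ^ 2 - N * ‖z‖ ^ 2| ≤ δ * N * ‖z‖ ^ 2) :
    |inner ℝ (T x) (T y) - N * inner ℝ x y| ≤ δ * N := by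
  have h1 := abs_le.1 (h (x + y) (by simp))
  have h2 := abs_le.1 (h (x - y) (by simp))
  rw [map_add, norm_add_sq_real, norm_add_sq_real, hx, hy] at h1
  rw [map_sub, norm_sub_sq_real, norm_sub_sq_real, hx, hy] at h2
  rw [abs_le]
  -- Polarization: the two errors add up to `δN(‖x + y‖² + ‖x - y‖²) = 4δN`.
  constructor <;> linarith [h1.1, h1.2, h2.1, h2.2]

/-- Expand both squares bilinearly: the errors, weighted by `|w i * w j|`, sum to the square of the
total weight. This is how the `A`-norm enters. -/
theorem le_norm_sq_map_sum {ι : Type*} [Fintype ι] (T : E →ₗ[ℝ] F) {N δ : ℝ} (v : ι → E)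
    (h : ∀ i j, |inner ℝ (T (v i)) (T (v j)) - N * inner ℝ (v i) (v j)| ≤ δ * N) (w : ι → ℝ) :
    N * ‖∑ i, w i • v i‖ ^ 2 - δ * N * (∑ i, |w i|) ^ 2 ≤ ‖T (∑ i, w i • v i)‖ ^ 2 := by
  rw [← real_inner_self_eq_norm_sq, ← real_inner_self_eq_norm_sq, map_sum, sub_le_iff_le_add,
    ← sub_le_iff_le_add', sq (∑ i, |w i|)]
  simp_rw [sum_inner, inner_sum, map_smul, real_inner_smul_left, real_inner_smul_right,
    Finset.sum_mul_sum, Finset.mul_sum, ← Finset.sum_sub_distrib]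
  refine Finset.sum_le_sum fun i _ => Finset.sum_le_sum fun j _ => ?_
  have h3 := mul_le_mul_of_nonneg_left (h i j) (abs_nonneg (w i * w j))
  rw [← abs_mul, abs_mul (w i)] at h3
  have h4 := (abs_le.1 h3).1
  linarith

/-- A linear map that almost preserves all inner products among `b` and the generators of a cone
keeps the image of `b` outside the image of the cone. -/
theorem map_notMem_cone {m n : ℕ} {a : Fin n → EuclideanSpace ℝ (Fin m)}
    {b p : EuclideanSpace ℝ (Fin m)} (hp : IsProjOn (cone a) b p) (hb : ‖b‖ = 1)
    (hbC : b ∉ cone a) {δ : ℝ} (hδ0 : 0 < δ)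
    (hδ : δ < ‖b - p‖ ^ 2 / (muA a ^ 2 + 2 * ‖p‖ * muA a + 1))
    (T : EuclideanSpace ℝ (Fin m) →ₗ[ℝ] F) {N : ℝ} (hN : 0 < N)
    (h : ∀ i j : Fin (n + 1), |inner ℝ (T ((Fin.cons b a : Fin (n + 1) → _) i))
        (T ((Fin.cons b a : Fin (n + 1) → _) j)) -
      N * inner ℝ ((Fin.cons b a : Fin (n + 1) → _) i) ((Fin.cons b a : Fin (n + 1) → _) j)|
        ≤ δ * N) :
    T b ∉ cone fun i => T (a i) := by
  rintro ⟨l, hl, hTb⟩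
  set x := ∑ i, l i • a i with hx
  have hxC : x ∈ cone a := ⟨l, hl, hx⟩
  have hTx : T (b - x) = 0 := by simp [hx, hTb]
  have hlow : Real.sqrt (‖b - x‖ ^ 2 / δ) - 1 ≤ aNorm a x := by
    -- The weights `l` only produce `x`; the estimate holds for every representation `l'` of `x`,
    -- hence for the infimum.
    refine le_aNorm hxC fun l' hl' hxl' => ?_
    have h1 := le_norm_sq_map_sum T (Fin.cons b a : Fin (n + 1) → _) h
      (Fin.cons 1 (fun i => - l' i) : Fin (n + 1) → ℝ)
    have h2 : ∑ i, (Fin.cons 1 (fun i => - l' i) : Fin (n + 1) → ℝ) i •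
        (Fin.cons b a : Fin (n + 1) → EuclideanSpace ℝ (Fin m)) i = b - x := by
      simp [Fin.sum_univ_succ, hxl', sub_eq_add_neg]
    have h3 : ∑ i, |(Fin.cons 1 (fun i => - l' i) : Fin (n + 1) → ℝ) i| = 1 + ∑ i, l' i := by
      simp [Fin.sum_univ_succ, abs_of_nonneg, hl']
    rw [h2, h3, hTx, norm_zero] at h1
    have hL : 0 ≤ ∑ i, l' i := Finset.sum_nonneg fun i _ => hl' i
    rw [sub_le_iff_le_add', Real.sqrt_le_left (by positivity), div_le_iff₀ hδ0]
    have h4 : N * ‖b - x‖ ^ 2 ≤ N * ((1 + ∑ i, l' i) ^ 2 * δ) := by linarith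
    exact le_of_mul_le_mul_left h4 hN
  have h5 := hlow.trans (aNorm_le_muA_mul_norm a hxC)
  have hμ := muA_nonneg a
  rw [sub_le_iff_le_add', Real.sqrt_le_left (by positivity), div_le_iff₀ hδ0] at h5
  linarith [hp.mul_sq_lt hb hbC hδ0.le hδ hxC]

end NearIsometry

/-! ### Concentration of sums of squares of sub-Gaussian variables -/

section SquareTail

theorem lintegral_exp_sq_div_four_gaussianReal :
    ∫⁻ x, ENNReal.ofReal (Real.exp (x ^ 2 / 4)) ∂(gaussianReal 0 1) = ENNReal.ofReal (√2) := by
  rw [gaussianReal_of_var_ne_zero _ one_ne_zero,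
    lintegral_withDensity_eq_lintegral_mul _ (measurable_gaussianPDF 0 1) (by fun_prop)]
  have h : ∀ x : ℝ, (gaussianPDF 0 1 * fun x => ENNReal.ofReal (Real.exp (x ^ 2 / 4))) x =
      ENNReal.ofReal ((√(2 * Real.pi))⁻¹ * Real.exp (-(1 / 4) * x ^ 2)) := by
    intro x
    rw [Pi.mul_apply, gaussianPDF_def, ← ENNReal.ofReal_mul (gaussianPDFReal_nonneg _ _ _),
      gaussianPDFReal_def]
    simp only [NNReal.coe_one, mul_one, sub_zero]
    rw [mul_assoc, ← Real.exp_add]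
    ring_nf
  simp_rw [h]
  rw [← ofReal_integral_eq_lintegral_ofReal
    ((integrable_exp_neg_mul_sq (by norm_num)).const_mul _) (ae_of_all _ fun x => by positivity),
    integral_const_mul, integral_gaussian, ← Real.sqrt_inv, ← Real.sqrt_mul (by positivity)]
  congr 2
  field_simp
  norm_num

variable {Ω : Type*} [MeasurableSpace Ω] {μ : Measure Ω} [IsProbabilityMeasure μ]

/-- Linearize the square with an independent standard Gaussian `g`: `exp(X²/4) = E_g exp(Xg/√2)`.
After Tonelli the sub-Gaussian bound in `X` leaves `E exp(g²/4) = √2`. -/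
theorem lintegral_exp_sq_div_four_le {X : Ω → ℝ} (hX : HasSubgaussianMGF X 1 μ) :
    ∫⁻ ω, ENNReal.ofReal (Real.exp (X ω ^ 2 / 4)) ∂μ ≤ ENNReal.ofReal (√2) := by
  have hm := hX.aemeasurable
  have h1 : ∀ ω, ENNReal.ofReal (Real.exp (X ω ^ 2 / 4)) =
      ∫⁻ g, ENNReal.ofReal (Real.exp (√(1 / 2) * X ω * g)) ∂(gaussianReal 0 1) := by
    intro ω
    have h := congr_fun (mgf_fun_id_gaussianReal (μ := 0) (v := 1)) (√(1 / 2) * X ω)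
    rw [mgf] at h
    rw [← ofReal_integral_eq_lintegral_ofReal (integrable_exp_mul_gaussianReal _)
      (ae_of_all _ fun x => by positivity), h, mul_pow, Real.sq_sqrt (by norm_num)]
    congr 2
    simp only [NNReal.coe_one]
    ring
  simp_rw [h1]
  rw [lintegral_lintegral_swap]
  · rw [← lintegral_exp_sq_div_four_gaussianReal]
    refine lintegral_mono fun g => ?_
    have hint := hX.integrable_exp_mul (√(1 / 2) * g)
    have hle := hX.mgf_le (√(1 / 2) * g)
    rw [mgf] at hle
    have h2 : ∀ ω, √(1 / 2) * X ω * g = √(1 / 2) * g * X ω := fun ω => by ring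
    simp_rw [h2]
    rw [← ofReal_integral_eq_lintegral_ofReal hint (ae_of_all _ fun x => by positivity)]
    refine ENNReal.ofReal_le_ofReal (hle.trans_eq ?_)
    rw [mul_pow, Real.sq_sqrt (by norm_num)]
    congr 1
    simp only [NNReal.coe_one]
    ring
  · have : AEMeasurable (fun z : Ω × ℝ => X z.1) (μ.prod (gaussianReal 0 1)) := hm.comp_fst
    simp only [Function.uncurry_def]
    fun_prop

theorem integrable_exp_sq_div_four {X : Ω → ℝ} (hX : HasSubgaussianMGF X 1 μ) :
    Integrable (fun ω => Real.exp (X ω ^ 2 / 4)) μ := by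
  have hm := hX.aemeasurable
  refine ⟨by fun_prop, ?_⟩
  rw [hasFiniteIntegral_iff_ofReal (ae_of_all _ fun x => by positivity)]
  exact (lintegral_exp_sq_div_four_le hX).trans_lt ENNReal.ofReal_lt_top

theorem integral_exp_sq_div_four_le {X : Ω → ℝ} (hX : HasSubgaussianMGF X 1 μ) :
    ∫ ω, Real.exp (X ω ^ 2 / 4) ∂μ ≤ √2 := by
  have h := lintegral_exp_sq_div_four_le hX
  rwa [← ofReal_integral_eq_lintegral_ofReal (integrable_exp_sq_div_four hX)
    (ae_of_all _ fun x => by positivity), ENNReal.ofReal_le_ofReal_iff (by positivity)] at h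

/-- Second-order Taylor remainder `u² exp|u|` at `u = tx²`, with `|u| ≤ x²/8` and `x⁴ ≤ 128
exp(x²/8)`. -/
theorem exp_mul_sq_le {t : ℝ} (ht : |t| ≤ 1 / 8) (x : ℝ) :
    Real.exp (t * x ^ 2) ≤ 1 + t * x ^ 2 + 128 * t ^ 2 * Real.exp (x ^ 2 / 4) := by
  have h1 := Complex.norm_exp_sub_sum_le_norm_mul_exp ((t * x ^ 2 : ℝ) : ℂ) 2
  rw [Complex.norm_real, Real.norm_eq_abs] at h1
  have h2 : Complex.exp ((t * x ^ 2 : ℝ) : ℂ) -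
      ∑ i ∈ Finset.range 2, ((t * x ^ 2 : ℝ) : ℂ) ^ i / (i.factorial : ℂ) =
      ((Real.exp (t * x ^ 2) - (1 + t * x ^ 2) : ℝ) : ℂ) := by
    simp [Finset.sum_range_succ]
  rw [h2, Complex.norm_real, Real.norm_eq_abs, sq_abs] at h1
  have h3 := (le_abs_self _).trans h1
  have h4 : Real.exp |t * x ^ 2| ≤ Real.exp (x ^ 2 / 8) := by
    rw [abs_mul, abs_of_nonneg (sq_nonneg x)]
    gcongr
    nlinarith [sq_nonneg x]
  have h5 : (x ^ 2) ^ 2 ≤ 128 * Real.exp (x ^ 2 / 8) := by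
    have := Real.quadratic_le_exp_of_nonneg (x := x ^ 2 / 8) (by positivity)
    nlinarith [sq_nonneg x]
  have h6 : Real.exp (x ^ 2 / 4) = Real.exp (x ^ 2 / 8) * Real.exp (x ^ 2 / 8) := by
    rw [← Real.exp_add]; ring_nf
  have h7 : (t * x ^ 2) ^ 2 * Real.exp |t * x ^ 2| ≤ 128 * t ^ 2 * Real.exp (x ^ 2 / 4) := by
    calc (t * x ^ 2) ^ 2 * Real.exp |t * x ^ 2|
        = t ^ 2 * ((x ^ 2) ^ 2 * Real.exp |t * x ^ 2|) := by ring
      _ ≤ t ^ 2 * (128 * Real.exp (x ^ 2 / 8) * Real.exp (x ^ 2 / 8)) := by gcongr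
      _ = _ := by rw [h6]; ring
  linarith

theorem integrable_exp_mul_sq {X : Ω → ℝ} (hX : HasSubgaussianMGF X 1 μ) {t : ℝ}
    (ht : |t| ≤ 1 / 8) : Integrable (fun ω => Real.exp (t * X ω ^ 2)) μ := by
  have hm := hX.aemeasurable
  refine (integrable_exp_sq_div_four hX).mono' (by fun_prop) (ae_of_all _ fun ω => ?_)
  rw [Real.norm_eq_abs, Real.abs_exp]
  gcongr
  nlinarith [sq_nonneg (X ω), (abs_le.1 ht).2]

/-- The square of a sub-Gaussian random variable is locally sub-exponential. -/
theorem mgf_sq_le {X : Ω → ℝ} (hX : HasSubgaussianMGF X 1 μ) {σ t : ℝ}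
    (hσ : ∫ ω, X ω ^ 2 ∂μ = σ) (ht : |t| ≤ 1 / 8) :
    mgf (fun ω => X ω ^ 2) μ t ≤ Real.exp (t * σ + 200 * t ^ 2) := by
  have hsq : Integrable (fun ω => X ω ^ 2) μ := (hX.memLp 2).integrable_sq
  have hE := integrable_exp_sq_div_four hX
  have h1 : mgf (fun ω => X ω ^ 2) μ t ≤ 1 + t * σ + 128 * t ^ 2 * √2 := by
    rw [mgf]
    refine (integral_mono (integrable_exp_mul_sq hX ht)
      (((integrable_const 1).add (hsq.const_mul t)).add (hE.const_mul (128 * t ^ 2)))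
      fun ω => exp_mul_sq_le ht (X ω)).trans ?_
    rw [integral_add' ((integrable_const 1).add (hsq.const_mul t)) (hE.const_mul _),
      integral_add' (integrable_const 1) (hsq.const_mul t), integral_const_mul,
      integral_const_mul, hσ]
    simp only [integral_const, probReal_univ, smul_eq_mul, one_mul]
    gcongr
    exact integral_exp_sq_div_four_le hX
  -- Hence `128√2 ≤ 192 ≤ 200`.
  have h2 : √2 ≤ 3 / 2 := by
    rw [Real.sqrt_le_left (by norm_num)]; norm_num
  have h3 := Real.add_one_le_exp (t * σ + 200 * t ^ 2)
  nlinarith [sq_nonneg t]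

/-- Concentration of a sum of squares of independent sub-Gaussian random variables. -/
theorem measureReal_sum_sq_le {k : ℕ} {X : Fin k → Ω → ℝ} (hind : iIndepFun X μ)
    (hX : ∀ i, HasSubgaussianMGF (X i) 1 μ) {σ : ℝ} (hσ : ∀ i, ∫ ω, X i ω ^ 2 ∂μ = σ) {η : ℝ}
    (hη0 : 0 ≤ η) (hη1 : η ≤ 1) :
    μ.real {ω | η * k ≤ |∑ i, X i ω ^ 2 - σ * k|} ≤ 2 * Real.exp (-(η ^ 2 / 800 * k)) := by
  have hm : ∀ i, AEMeasurable (fun ω => X i ω ^ 2) μ := fun i => (hX i).aemeasurable.pow_const 2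
  have hind2 : iIndepFun (fun i ω => X i ω ^ 2) μ :=
    hind.comp (fun _ x => x ^ 2) fun _ => by fun_prop
  let S : Ω → ℝ := ∑ i, fun ω => X i ω ^ 2
  have hS : ∀ ω, S ω = ∑ i, X i ω ^ 2 := fun ω => by simp [S]
  have hmgf : ∀ t : ℝ, |t| ≤ 1 / 8 → mgf S μ t ≤ Real.exp (k * (t * σ + 200 * t ^ 2)) := by
    intro t ht
    rw [hind2.mgf_sum₀ hm, Real.exp_nat_mul]
    calc ∏ i, mgf (fun ω => X i ω ^ 2) μ t
        ≤ ∏ _i : Fin k, Real.exp (t * σ + 200 * t ^ 2) :=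
          Finset.prod_le_prod (fun _ _ => mgf_nonneg) fun i _ => mgf_sq_le (hX i) (hσ i) ht
      _ = _ := by simp
  have hint : ∀ t : ℝ, |t| ≤ 1 / 8 → Integrable (fun ω => Real.exp (t * S ω)) μ := by
    intro t ht
    -- A non-integrable exponential would have default `mgf` zero, but the `mgf` of the sum is a
    -- product of positive factors.
    by_contra hni
    have h0 := mgf_undef hni
    rw [hind2.mgf_sum₀ hm, Finset.prod_eq_zero_iff] at h0
    obtain ⟨i, -, hi⟩ := h0
    exact (mgf_pos (integrable_exp_mul_sq (hX i) ht)).ne' hi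
  have hup : μ.real {ω | (σ + η) * k ≤ S ω} ≤ Real.exp (-(η ^ 2 / 800 * k)) := by
    have ht : |η / 400| ≤ 1 / 8 := by rw [abs_of_nonneg (by positivity)]; linarith
    -- `t = η/400` minimizes the Chernoff exponent `200t² - tη`, with value `-η²/800`.
    refine (measure_ge_le_exp_mul_mgf _ (t := η / 400) (by positivity) (hint _ ht)).trans ?_
    refine (mul_le_mul_of_nonneg_left (hmgf _ ht) (by positivity)).trans_eq ?_
    rw [← Real.exp_add]
    ring_nf
  have hlo : μ.real {ω | S ω ≤ (σ - η) * k} ≤ Real.exp (-(η ^ 2 / 800 * k)) := by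
    have ht : |-(η / 400)| ≤ 1 / 8 := by rw [abs_neg, abs_of_nonneg (by positivity)]; linarith
    refine (measure_le_le_exp_mul_mgf _ (t := -(η / 400))
      (neg_nonpos.2 (by positivity)) (hint _ ht)).trans ?_
    refine (mul_le_mul_of_nonneg_left (hmgf _ ht) (by positivity)).trans_eq ?_
    rw [← Real.exp_add]
    ring_nf
  calc μ.real {ω | η * k ≤ |∑ i, X i ω ^ 2 - σ * k|}
      ≤ μ.real ({ω | (σ + η) * k ≤ S ω} ∪ {ω | S ω ≤ (σ - η) * k}) := by
        refine measureReal_mono fun ω hω => ?_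
        simp only [Set.mem_ofPred_eq, le_abs, ← hS] at hω
        rcases hω with h | h
        · left; simp only [Set.mem_ofPred_eq]; linarith
        · right; simp only [Set.mem_ofPred_eq]; linarith
    _ ≤ _ := (measureReal_union_le _ _).trans (by linarith)

end SquareTail

/-! ### Norm concentration for independent entries -/

section IndepEntries

variable {Ω : Type*} [MeasurableSpace Ω] {Pr : Measure Ω} {k m : ℕ}

/-- The squared norm of the image of every unit vector under `P` concentrates around a common
value `N`, with a rate exponential in the number of rows. -/
def NormConcentration (c : ℝ) (P : Ω → Matrix (Fin k) (Fin m) ℝ) (Pr : Measure Ω) : Prop :=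
  ∃ N : ℝ, 0 < N ∧ ∀ x : EuclideanSpace ℝ (Fin m), ‖x‖ = 1 → ∀ δ : ℝ, 0 < δ → δ ≤ 1 →
    Pr.real {ω | δ * N ≤ |‖Matrix.toEuclideanLin (P ω) x‖ ^ 2 - N|} ≤
      4 * Real.exp (-(c * δ ^ 2 * k))

/-- The rows of a matrix of independent identically distributed variables are independent. -/
theorem iIndepFun_rows {ι κ : Type*} [Fintype ι] [Fintype κ] [IsProbabilityMeasure Pr]
    {X : ι → κ → Ω → ℝ} {ν : Measure ℝ} [IsProbabilityMeasure ν]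
    (hlaw : ∀ i j, HasLaw (X i j) ν Pr) (hind : iIndepFun (fun (p : ι × κ) => X p.1 p.2) Pr) :
    iIndepFun (fun i ω j => X i j ω) Pr := by
  have hm : ∀ i j, AEMeasurable (X i j) Pr := fun i j => (hlaw i j).aemeasurable
  have hrow : ∀ i, AEMeasurable (fun ω j => X i j ω) Pr := fun i => aemeasurable_pi_lambda _ (hm i)
  -- The joint law is written with `infinitePi` so that currying turns it into a product of row
  -- laws.
  have hpi : Pr.map (fun ω (p : ι × κ) => X p.1 p.2 ω) =
      Measure.infinitePi fun _ : ι × κ => ν := by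
    rw [hind.map_fun_eq_pi_map fun p : ι × κ => hm p.1 p.2, Measure.infinitePi_eq_pi]
    exact congrArg _ (funext fun p => (hlaw p.1 p.2).map_eq)
  have hcurry : Pr.map (fun ω i j => X i j ω) =
      Measure.pi fun _ : ι => Measure.pi fun _ : κ => ν := by
    have h1 := congrArg (Measure.map (MeasurableEquiv.curry ι κ ℝ)) hpi
    rw [Measure.infinitePi_map_curry (fun _ _ => ν), AEMeasurable.map_map_of_aemeasurable
      (MeasurableEquiv.measurable _).aemeasurable (aemeasurable_pi_lambda _ fun p : ι × κ => hm p.1 p.2),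
      Measure.infinitePi_eq_pi] at h1
    simp_rw [Measure.infinitePi_eq_pi] at h1
    exact h1
  rw [iIndepFun_iff_map_fun_eq_pi_map hrow, hcurry]
  congr 1
  funext i
  have h2 : iIndepFun (fun j => X i j) Pr :=
    hind.precomp (g := fun j => (i, j)) fun j j' hj => (Prod.mk.inj hj).2
  rw [h2.map_fun_eq_pi_map (hm i)]
  exact congrArg _ (funext fun j => (hlaw i j).map_eq.symm)

theorem toEuclideanLin_norm_sq (M : Matrix (Fin k) (Fin m) ℝ) (x : EuclideanSpace ℝ (Fin m)) :
    ‖Matrix.toEuclideanLin M x‖ ^ 2 = ∑ i, (∑ j, x j * M i j) ^ 2 := by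
  rw [EuclideanSpace.real_norm_sq_eq]
  refine Finset.sum_congr rfl fun i _ => ?_
  simp [Matrix.toLpLin_apply, Matrix.mulVec, dotProduct, mul_comm]

/-- Linear combinations, with unit coefficient vector, of independent sub-Gaussian variables. -/
theorem hasSubgaussianMGF_unit_combination [IsProbabilityMeasure Pr] {Y : Fin m → Ω → ℝ}
    (hind : iIndepFun Y Pr)
    (hY : ∀ j, HasSubgaussianMGF (Y j) 1 Pr) {x : EuclideanSpace ℝ (Fin m)} (hx : ‖x‖ = 1) :
    HasSubgaussianMGF (fun ω => ∑ j, x j * Y j ω) 1 Pr := by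
  have h1 : iIndepFun (fun j ω => x j * Y j ω) Pr :=
    hind.comp (fun j y => x j * y) fun _ => by fun_prop
  have h2 := HasSubgaussianMGF.sum_of_iIndepFun h1 (s := Finset.univ)
    fun j _ => (hY j).const_mul (x j)
  convert h2 using 1
  rw [← NNReal.coe_inj]
  rw [NNReal.coe_sum, NNReal.coe_one, ← one_pow 2, ← hx, EuclideanSpace.real_norm_sq_eq]
  exact Finset.sum_congr rfl fun j _ => (mul_one (x j ^ 2)).symm

theorem integral_unit_combination_sq [IsProbabilityMeasure Pr] {Y : Fin m → Ω → ℝ} {σ : ℝ}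
    (hind : iIndepFun Y Pr)
    (hY : ∀ j, HasSubgaussianMGF (Y j) 1 Pr) (h0 : ∀ j, ∫ ω, Y j ω ∂Pr = 0)
    (hσ : ∀ j, ∫ ω, Y j ω ^ 2 ∂Pr = σ) {x : EuclideanSpace ℝ (Fin m)} (hx : ‖x‖ = 1) :
    ∫ ω, (∑ j, x j * Y j ω) ^ 2 ∂Pr = σ := by
  have hint : ∀ i j, Integrable (fun ω => Y i ω * Y j ω) Pr := fun i j =>
    MemLp.integrable_mul (p := 2) (q := 2) ((hY i).memLp 2) ((hY j).memLp 2)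
  have hcross : ∀ i j, ∫ ω, Y i ω * Y j ω ∂Pr = if i = j then σ else 0 := by
    intro i j
    split_ifs with hij
    · subst hij; simp_rw [← sq]; exact hσ i
    · rw [(hind.indepFun hij).integral_fun_mul_eq_mul_integral
        (hY i).aestronglyMeasurable (hY j).aestronglyMeasurable, h0, zero_mul]
  have hexp : ∀ ω, (∑ j, x j * Y j ω) ^ 2 = ∑ i, ∑ j, x i * x j * (Y i ω * Y j ω) := fun ω => by
    rw [sq, Finset.sum_mul_sum]
    exact Finset.sum_congr rfl fun i _ => Finset.sum_congr rfl fun j _ => mul_mul_mul_comm _ _ _ _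
  simp_rw [hexp]
  rw [integral_finsetSum _ fun i _ => integrable_finsetSum _ fun j _ => (hint i j).const_mul _]
  simp_rw [integral_finsetSum _ fun j _ => (hint _ j).const_mul _, integral_const_mul, hcross]
  simp only [mul_ite, mul_zero, Finset.sum_ite_eq, Finset.mem_univ, if_true, ← sq]
  rw [← Finset.sum_mul, ← EuclideanSpace.real_norm_sq_eq, hx, one_pow, one_mul]

/-- The coordinates of `P x` are independent, sub-Gaussian and of variance `σ`, so `N = σk` and the
relative error `δ` is the absolute error `η = δσ` per row. As `σ ≥ 1/3`, the rate is at least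
`δ²/7200`; the smaller constant is the one the subspace case needs. -/
theorem HasIndepEntries.normConcentration [IsProbabilityMeasure Pr]
    {P : Ω → Matrix (Fin k) (Fin m) ℝ} {ν : Measure ℝ}
    [IsProbabilityMeasure ν] (hk : 0 < k) (h : HasIndepEntries P Pr ν)
    (hν : HasSubgaussianMGF id 1 ν) (h0 : ∫ y, y ∂ν = 0) {σ : ℝ}
    (hσ : ∫ y, y ^ 2 ∂ν = σ) (hσ3 : 1 / 3 ≤ σ) (hσ1 : σ ≤ 1) :
    NormConcentration (1 / 12800) P Pr := by
  have hkR : (0 : ℝ) < k := Nat.cast_pos.2 hk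
  refine ⟨σ * k, by positivity, fun x hx δ hδ0 hδ1 => ?_⟩
  have hsub : ∀ i j, HasSubgaussianMGF (fun ω => P ω i j) 1 Pr := fun i j => by
    refine HasSubgaussianMGF.of_map (X := id) (h.1 i j).aemeasurable ?_
    rwa [(h.1 i j).map_eq]
  have hz : ∀ i j, ∫ ω, P ω i j ∂Pr = 0 := fun i j => (h.1 i j).integral_eq.trans h0
  have hs : ∀ i j, ∫ ω, P ω i j ^ 2 ∂Pr = σ := fun i j =>
    ((h.1 i j).integral_comp (f := fun y : ℝ => y ^ 2) (by fun_prop)).trans hσ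
  have hcol : ∀ i, iIndepFun (fun j ω => P ω i j) Pr := fun i =>
    h.2.precomp (g := fun j => (i, j)) fun j j' hj => (Prod.mk.inj hj).2
  have hind : iIndepFun (fun i ω => ∑ j, x j * P ω i j) Pr :=
    (iIndepFun_rows h.1 h.2).comp (fun _ (r : Fin m → ℝ) => ∑ j, x j * r j) fun _ => by fun_prop
  have hmain := measureReal_sum_sq_le hind
    (fun i => hasSubgaussianMGF_unit_combination (hcol i) (hsub i) hx)
    (fun i => integral_unit_combination_sq (hcol i) (hsub i) (hz i) (hs i) hx)
    (η := δ * σ) (by positivity) (mul_le_one₀ hδ1 (by positivity) hσ1)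
  simp_rw [toEuclideanLin_norm_sq, ← mul_assoc]
  refine hmain.trans ?_
  gcongr
  · norm_num
  · have hσ2 : (1 / 3) ^ 2 ≤ σ ^ 2 := by gcongr
    nlinarith [mul_le_mul_of_nonneg_left hσ2 (sq_nonneg δ)]

end IndepEntries

/-! ### Moments and sub-Gaussianity of the three entry laws -/

section Laws

instance : IsProbabilityMeasure signLaw := by
  refine ⟨?_⟩
  simp [signLaw, ENNReal.inv_two_add_inv_two]

instance : IsProbabilityMeasure sparseLaw := by
  refine ⟨?_⟩
  simp only [sparseLaw, Measure.coe_add, Measure.coe_smul, Pi.add_apply, Pi.smul_apply,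
    measure_univ, smul_eq_mul, mul_one]
  rw [← ENNReal.toReal_eq_one_iff, ENNReal.toReal_add (by finiteness) (by finiteness),
    ENNReal.toReal_add (by finiteness) (by finiteness)]
  norm_num

theorem integral_signLaw (f : ℝ → ℝ) : ∫ y, f y ∂signLaw = (f 1 + f (-1)) / 2 := by
  rw [signLaw, integral_add_measure, integral_smul_measure, integral_smul_measure, integral_dirac,
    integral_dirac]
  · simp; ring
  all_goals exact (integrable_dirac (by finiteness)).smul_measure (by finiteness)

theorem integral_sparseLaw (f : ℝ → ℝ) :
    ∫ y, f y ∂sparseLaw = f 1 / 6 + 2 / 3 * f 0 + f (-1) / 6 := by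
  rw [sparseLaw, integral_add_measure, integral_add_measure, integral_smul_measure,
    integral_smul_measure, integral_smul_measure, integral_dirac, integral_dirac, integral_dirac]
  · simp; ring
  all_goals
    first
    | exact (integrable_dirac (by finiteness)).smul_measure (by finiteness)
    | exact ((integrable_dirac (by finiteness)).smul_measure (by finiteness)).add_measure
        ((integrable_dirac (by finiteness)).smul_measure (by finiteness))

theorem hasSubgaussianMGF_id_of_ae_mem_Icc {ν : Measure ℝ} [IsProbabilityMeasure ν]
    (h : ∀ᵐ y ∂ν, y ∈ Set.Icc (-1 : ℝ) 1) (h0 : ∫ y, y ∂ν = 0) : HasSubgaussianMGF id 1 ν := by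
  convert hasSubgaussianMGF_of_mem_Icc_of_integral_eq_zero (X := id) (a := -1) (b := 1)
    aemeasurable_id h h0
  rw [← NNReal.coe_inj]
  norm_num

theorem hasSubgaussianMGF_id_gaussianReal : HasSubgaussianMGF id 1 (gaussianReal 0 1) where
  integrable_exp_mul t := integrable_exp_mul_gaussianReal t
  mgf_le t := by rw [mgf_id_gaussianReal]; simp

theorem integral_sq_gaussianReal : ∫ y, y ^ 2 ∂(gaussianReal 0 1) = 1 := by
  have h := variance_id_gaussianReal (μ := 0) (v := 1)
  rw [variance_of_integral_eq_zero aemeasurable_id (by simp)] at h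
  simpa using h

theorem ae_signLaw : ∀ᵐ y ∂signLaw, y ∈ Set.Icc (-1 : ℝ) 1 := by
  simp [signLaw, ae_add_measure_iff]

theorem ae_sparseLaw : ∀ᵐ y ∂sparseLaw, y ∈ Set.Icc (-1 : ℝ) 1 := by
  simp [sparseLaw, ae_add_measure_iff]

end Laws

/-! ### Norm concentration for uniform random subspaces -/

section UniformProjection

/-- The image of a standard Gaussian vector under a linear map with `L L† = 1` is standard
Gaussian. -/
theorem map_stdGaussian_of_comp_adjoint {E F : Type*} [NormedAddCommGroup E]
    [InnerProductSpace ℝ E] [FiniteDimensional ℝ E] [MeasurableSpace E] [BorelSpace E]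
    [NormedAddCommGroup F] [InnerProductSpace ℝ F] [FiniteDimensional ℝ F] [MeasurableSpace F]
    [BorelSpace F] (L : E →L[ℝ] F)
    (hL : ∀ y, L (ContinuousLinearMap.adjoint L y) = y) :
    (stdGaussian E).map L = stdGaussian F := by
  apply Measure.ext_of_charFun
  ext t
  rw [charFun_stdGaussian, charFun_apply, integral_map (by fun_prop) (by fun_prop)]
  simp_rw [← ContinuousLinearMap.adjoint_inner_right]
  have hnorm : ‖ContinuousLinearMap.adjoint L t‖ ^ 2 = ‖t‖ ^ 2 := by
    rw [← real_inner_self_eq_norm_sq, ContinuousLinearMap.adjoint_inner_left, hL,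
      real_inner_self_eq_norm_sq]
  rw [← charFun_apply, charFun_stdGaussian]
  exact_mod_cast congrArg (fun r : ℝ => Complex.exp (-r / 2)) hnorm

/-- Concentration of the squared norm of a standard Gaussian vector. -/
theorem stdGaussian_norm_sq_le {k : ℕ} {η : ℝ} (hη0 : 0 ≤ η) (hη1 : η ≤ 1) :
    (stdGaussian (EuclideanSpace ℝ (Fin k))).real {g | η * k ≤ |‖g‖ ^ 2 - k|} ≤
      2 * Real.exp (-(η ^ 2 / 800 * k)) := by
  have hind : iIndepFun (fun (i : Fin k) (ω : Fin k → ℝ) => ω i)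
      (Measure.pi fun _ => gaussianReal 0 1) :=
    iIndepFun_pi (X := fun _ x => x) fun _ => aemeasurable_id'
  have hlaw : ∀ i : Fin k, HasLaw (fun ω : Fin k → ℝ => ω i) (gaussianReal 0 1)
      (Measure.pi fun _ => gaussianReal 0 1) := fun i =>
    (measurePreserving_eval (fun _ : Fin k => gaussianReal 0 1) i).hasLaw
  have hmain := measureReal_sum_sq_le hind (σ := 1)
    (fun i => by
      refine HasSubgaussianMGF.of_map (X := id) (hlaw i).aemeasurable ?_
      rw [(hlaw i).map_eq]
      exact hasSubgaussianMGF_id_gaussianReal)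
    (fun i => ((hlaw i).integral_comp (f := fun y : ℝ => y ^ 2) (by fun_prop)).trans
      integral_sq_gaussianReal) hη0 hη1
  rw [← map_pi_eq_stdGaussian, map_measureReal_apply (by fun_prop)
    (measurableSet_le (by fun_prop) (by fun_prop))]
  simpa only [Set.preimage, Set.mem_ofPred_eq, EuclideanSpace.real_norm_sq_eq, one_mul] using hmain

/-- Both `L g` and `g` are standard Gaussian, so `‖L g‖²` is close to `k` and `‖g‖²` to `m`.
Relative accuracy `δ/4` in each suffices for the ratio, whence `12800 = 16 * 800`. -/
theorem stdGaussian_ratio_le {k m : ℕ} (hk : 0 < k)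
    (L : EuclideanSpace ℝ (Fin m) →L[ℝ] EuclideanSpace ℝ (Fin k))
    (hL : ∀ y, L (ContinuousLinearMap.adjoint L y) = y) {δ : ℝ} (hδ0 : 0 < δ) (hδ1 : δ ≤ 1) :
    (stdGaussian (EuclideanSpace ℝ (Fin m))).real
        {g | δ * (k / m) * ‖g‖ ^ 2 ≤ |‖L g‖ ^ 2 - k / m * ‖g‖ ^ 2|} ≤
      4 * Real.exp (-(1 / 12800 * δ ^ 2 * k)) := by
  have hkm : k ≤ m := by
    have hsurj : Function.Surjective L := fun y => ⟨_, hL y⟩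
    have := LinearMap.finrank_le_finrank_of_surjective (f := L.toLinearMap) hsurj
    simpa using this
  have hkR : (0 : ℝ) < k := Nat.cast_pos.2 hk
  have hkmR : (k : ℝ) ≤ m := Nat.cast_le.2 hkm
  have hmR : (0 : ℝ) < m := hkR.trans_le hkmR
  set γ := stdGaussian (EuclideanSpace ℝ (Fin m))
  have h1 : γ.real {g | δ / 4 * k ≤ |‖L g‖ ^ 2 - k|} ≤
      2 * Real.exp (-((δ / 4) ^ 2 / 800 * k)) := by
    have h := stdGaussian_norm_sq_le (k := k) (η := δ / 4) (by positivity) (by linarith)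
    rwa [← map_stdGaussian_of_comp_adjoint L hL, map_measureReal_apply (by fun_prop)
      (measurableSet_le (by fun_prop) (by fun_prop))] at h
  have h2 : γ.real {g | δ / 4 * m ≤ |‖g‖ ^ 2 - m|} ≤
      2 * Real.exp (-((δ / 4) ^ 2 / 800 * k)) := by
    refine (stdGaussian_norm_sq_le (k := m) (η := δ / 4) (by positivity) (by linarith)).trans ?_
    gcongr
  calc _ ≤ γ.real ({g | δ / 4 * k ≤ |‖L g‖ ^ 2 - k|} ∪ {g | δ / 4 * m ≤ |‖g‖ ^ 2 - m|}) := by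
        refine measureReal_mono fun g hg => ?_
        by_contra hnot
        simp only [Set.mem_union, Set.mem_ofPred_eq, not_or, not_le, abs_lt] at hnot
        obtain ⟨⟨ha, hb⟩, hc, hd⟩ := hnot
        set G := ‖g‖ ^ 2
        have hq : ∃ q : ℝ, 0 < q ∧ q * m = k := ⟨k / m, by positivity, by field_simp⟩
        obtain ⟨q, hq0, hqm⟩ := hq
        have hqe : (k : ℝ) / m = q := by rw [← hqm]; field_simp
        simp only [Set.mem_ofPred_eq, hqe, le_abs] at hg
        have hc' := mul_lt_mul_of_pos_left hc hq0
        have hd' := mul_lt_mul_of_pos_left hd hq0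
        have hqδ : q * (δ / 4 * m) = δ / 4 * k := by rw [← hqm]; ring
        rw [mul_sub, hqm, mul_neg, hqδ] at hc'
        rw [mul_sub, hqm, hqδ] at hd'
        -- Off both bad events `‖L g‖²` and `qG` differ by less than `δk/2`, while `δqG` exceeds
        -- `3δk/4`.
        have hGd : δ * (k - δ / 4 * k) < δ * (q * G) :=
          mul_lt_mul_of_pos_left (by linarith) hδ0
        have hδk : δ * (δ * k) ≤ 1 * (δ * k) := by gcongr
        rcases hg with hg | hg <;> nlinarith
    _ ≤ _ := measureReal_union_le _ _
    _ ≤ _ := by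
        have : (δ / 4) ^ 2 / 800 * (k : ℝ) = 1 / 12800 * δ ^ 2 * k := by ring
        rw [this] at h1 h2
        linarith

variable {Ω : Type*} [MeasurableSpace Ω] {Pr : Measure Ω} {k m : ℕ}

theorem toEuclideanLin_apply_transpose {M : Matrix (Fin k) (Fin m) ℝ} (hM : M * Mᵀ = 1)
    (y : EuclideanSpace ℝ (Fin k)) :
    Matrix.toEuclideanLin M (Matrix.toEuclideanLin Mᵀ y) = y := by
  simp [Matrix.toLpLin_apply, Matrix.mulVec_mulVec, hM]

theorem stdGaussian_ratio_toEuclideanLin_le (hk : 0 < k) {M : Matrix (Fin k) (Fin m) ℝ}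
    (hM : M * Mᵀ = 1) {δ : ℝ} (hδ0 : 0 < δ) (hδ1 : δ ≤ 1) :
    (stdGaussian (EuclideanSpace ℝ (Fin m))).real
        {g | δ * (k / m) * ‖g‖ ^ 2 ≤ |‖Matrix.toEuclideanLin M g‖ ^ 2 - k / m * ‖g‖ ^ 2|} ≤
      4 * Real.exp (-(1 / 12800 * δ ^ 2 * k)) := by
  refine stdGaussian_ratio_le hk (Matrix.toEuclideanLin M).toContinuousLinearMap (fun y => ?_)
    hδ0 hδ1
  rw [← LinearMap.adjoint_toContinuousLinearMap, ← Matrix.toEuclideanLin_conjTranspose_eq_adjoint,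
    Matrix.conjTranspose_eq_transpose_of_trivial]
  exact toEuclideanLin_apply_transpose hM y

/-- Rotation invariance is assumed only for the law of `PᵀP`, so the norm has to be read off the
Gram matrix. -/
theorem toEuclideanLin_norm_sq_gram (M : Matrix (Fin k) (Fin m) ℝ) (x : EuclideanSpace ℝ (Fin m)) :
    ‖Matrix.toEuclideanLin M x‖ ^ 2 = x ⬝ᵥ ((Mᵀ * M) *ᵥ x) := by
  rw [← real_inner_self_eq_norm_sq, ← Matrix.mulVec_mulVec, Matrix.dotProduct_mulVec,
    Matrix.vecMul_transpose]
  rw [EuclideanSpace.inner_eq_star_dotProduct]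
  simp [Matrix.toLpLin_apply]

/-- Reflection in the hyperplane orthogonal to `x - y` exchanges the two vectors. -/
theorem exists_orthogonal_mulVec_eq {x y : EuclideanSpace ℝ (Fin m)} (h : ‖x‖ = ‖y‖) :
    ∃ U ∈ Matrix.orthogonalGroup (Fin m) ℝ, U *ᵥ x = y := by
  let f := (ℝ ∙ (x - y))ᗮ.reflection
  let e := EuclideanSpace.basisFun (Fin m) ℝ
  refine ⟨f.toMatrix e.toBasis e.toBasis, f.toMatrix_mem_unitaryGroup e e, ?_⟩
  have h1 := LinearMap.toMatrix_mulVec_repr e.toBasis e.toBasis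
    (f.toLinearEquiv : EuclideanSpace ℝ (Fin m) →ₗ[ℝ] EuclideanSpace ℝ (Fin m)) x
  have h2 : f x = y := Submodule.reflection_sub h
  have h3 : ∀ z, (e.toBasis.repr z : Fin m → ℝ) = z := fun z => funext fun i => by simp [e]
  rw [h3, h3] at h1
  exact h1.trans (congrArg _ h2)

/-- By rotation invariance, the law of `‖P x‖ ^ 2` only depends on the norm of `x`. -/
theorem IsUniformProjection.identDistrib {P : Ω → Matrix (Fin k) (Fin m) ℝ}
    (h : IsUniformProjection P Pr) {x y : EuclideanSpace ℝ (Fin m)} (hxy : ‖x‖ = ‖y‖) :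
    IdentDistrib (fun ω => ‖Matrix.toEuclideanLin (P ω) x‖ ^ 2)
      (fun ω => ‖Matrix.toEuclideanLin (P ω) y‖ ^ 2) Pr Pr := by
  obtain ⟨U, hU, hUy⟩ := exists_orthogonal_mulVec_eq hxy.symm
  have hUx : Uᵀ *ᵥ x = y := by
    have hUU : Uᵀ * U = 1 := Matrix.mem_orthogonalGroup_iff' _ _ |>.1 hU
    rw [← hUy, Matrix.mulVec_mulVec, hUU, Matrix.one_mulVec]
  have hid := (h.2.2 U hU).comp
    (u := fun Q : Fin m → Fin m → ℝ => ∑ i, x i * ∑ j, Q i j * x j) (by fun_prop)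
  have h1 : ∀ ω, ‖Matrix.toEuclideanLin (P ω) x‖ ^ 2 =
      ∑ i, x i * ∑ j, ((P ω)ᵀ * P ω) i j * x j := fun ω => toEuclideanLin_norm_sq_gram _ _
  have h2 : ∀ ω, ‖Matrix.toEuclideanLin (P ω) y‖ ^ 2 =
      ∑ i, x i * ∑ j, (U * ((P ω)ᵀ * P ω) * Uᵀ) i j * x j := fun ω => by
    refine (toEuclideanLin_norm_sq_gram _ _).trans ?_
    change _ = x ⬝ᵥ ((U * ((P ω)ᵀ * P ω) * Uᵀ) *ᵥ x)
    generalize (P ω)ᵀ * P ω = Q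
    rw [← Matrix.mulVec_mulVec, hUx, ← Matrix.mulVec_mulVec, Matrix.dotProduct_mulVec x U,
      ← Matrix.mulVec_transpose, hUx]
  simp_rw [h1, h2]
  exact hid.symm

/-- If all sections of a set in one direction have measure at least `A` and almost all sections in
the other direction have measure at most `B`, then `A ≤ B`. -/
theorem le_of_forall_le_section {Ω' : Type*} [MeasurableSpace Ω'] {μ : Measure Ω} {ν : Measure Ω'}
    [IsProbabilityMeasure μ] [IsProbabilityMeasure ν] {S : Set (Ω × Ω')}
    (hS : NullMeasurableSet S (μ.prod ν)) (hSg : ∀ g, NullMeasurableSet {ω | (ω, g) ∈ S} μ)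
    {A B : ENNReal} (hA : ∀ g, A ≤ μ {ω | (ω, g) ∈ S}) (hB : ∀ᵐ ω ∂μ, ν {g | (ω, g) ∈ S} ≤ B) :
    A ≤ B := by
  calc A = ∫⁻ _g, A ∂ν := by simp
    _ ≤ ∫⁻ g, μ {ω | (ω, g) ∈ S} ∂ν := lintegral_mono hA
    _ = ∫⁻ g, ∫⁻ ω, S.indicator 1 (ω, g) ∂μ ∂ν :=
        lintegral_congr fun g => (lintegral_indicator_one₀ (hSg g)).symm
    _ = ∫⁻ ω, ∫⁻ g, S.indicator 1 (ω, g) ∂ν ∂μ :=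
        (lintegral_lintegral_swap (f := fun ω g => S.indicator 1 (ω, g))
          (aemeasurable_one.indicator₀ hS)).symm
    _ ≤ ∫⁻ _ω, B ∂μ :=
        lintegral_mono_ae (hB.mono fun ω hω => (lintegral_indicator_one_le _).trans hω)
    _ = B := by simp

/-- In the product with a Gaussian `g`, every section at fixed `g` is at least as likely as the bad
event for `x`, by invariance and homogeneity. Almost every section at fixed `P` is small by the
Gaussian ratio estimate. -/
theorem IsUniformProjection.normConcentration [IsProbabilityMeasure Pr]
    {P : Ω → Matrix (Fin k) (Fin m) ℝ} (hk : 0 < k) (h : IsUniformProjection P Pr) :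
    NormConcentration (1 / 12800) P Pr := by
  have hkR : (0 : ℝ) < k := Nat.cast_pos.2 hk
  have hkm : k ≤ m := by
    obtain ⟨ω, hω⟩ := h.2.1.exists
    have := LinearMap.finrank_le_finrank_of_surjective (f := Matrix.toEuclideanLin (P ω))
      fun y => ⟨_, toEuclideanLin_apply_transpose hω y⟩
    simpa using this
  have hmR : (0 : ℝ) < m := hkR.trans_le (Nat.cast_le.2 hkm)
  refine ⟨k / m, by positivity, fun x hx δ hδ0 hδ1 => ?_⟩
  set γ := stdGaussian (EuclideanSpace ℝ (Fin m)) with hγ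
  let f : Ω → EuclideanSpace ℝ (Fin m) → ℝ := fun ω g => ‖Matrix.toEuclideanLin (P ω) g‖ ^ 2
  let S : Set (Ω × EuclideanSpace ℝ (Fin m)) :=
    {z | δ * (k / m) * ‖z.2‖ ^ 2 ≤ |f z.1 z.2 - k / m * ‖z.2‖ ^ 2|}
  have hf : AEMeasurable (fun z : Ω × EuclideanSpace ℝ (Fin m) => f z.1 z.2) (Pr.prod γ) := by
    have hP : ∀ i j, AEMeasurable (fun z : Ω × EuclideanSpace ℝ (Fin m) => P z.1 i j)
        (Pr.prod γ) := fun i j => (h.1 i j).comp_fst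
    have hz : ∀ j, AEMeasurable (fun z : Ω × EuclideanSpace ℝ (Fin m) => z.2 j) (Pr.prod γ) :=
      fun j => Measurable.aemeasurable (by fun_prop)
    simp only [f, toEuclideanLin_norm_sq]
    exact Finset.aemeasurable_fun_sum _ fun i _ => AEMeasurable.pow_const
      (Finset.aemeasurable_fun_sum _ fun j _ => (hz j).mul (hP i j)) 2
  have hfω : ∀ g, AEMeasurable (fun ω => f ω g) Pr := by
    intro g
    have hP := h.1
    simp only [f, toEuclideanLin_norm_sq]
    fun_prop
  have hS : NullMeasurableSet S (Pr.prod γ) :=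
    nullMeasurableSet_le (by fun_prop) (by fun_prop)
  have hsec : ∀ g, Pr {ω | δ * (k / m) ≤ |f ω x - k / m|} ≤ Pr {ω | (ω, g) ∈ S} := by
    intro g
    -- The inequality defining `S` is not strict, so at `g = 0` the section is everything.
    rcases eq_or_ne g 0 with rfl | hg
    · refine measure_mono fun ω _ => ?_
      simp [S]
    · have hg0 : 0 < ‖g‖ := norm_pos_iff.2 hg
      set y := ‖g‖⁻¹ • g with hy
      have hy1 : ‖y‖ = 1 := by rw [hy, norm_smul, norm_inv, norm_norm, inv_mul_cancel₀ hg0.ne']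
      have hgy : g = ‖g‖ • y := by rw [hy, smul_smul, mul_inv_cancel₀ hg0.ne', one_smul]
      have hfy : ∀ ω, f ω g = ‖g‖ ^ 2 * f ω y := fun ω => by
        simp only [f]
        conv_lhs => rw [hgy]
        rw [map_smul, norm_smul, norm_norm, mul_pow]
      have hBm : MeasurableSet {u : ℝ | δ * (k / m) ≤ |u - k / m|} :=
        measurableSet_le (by fun_prop) (by fun_prop)
      refine ((h.identDistrib (hx.trans hy1.symm)).measure_mem_eq hBm).trans_le ?_
      refine measure_mono fun ω hω => ?_
      change δ * (k / m) ≤ |f ω y - k / m| at hω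
      change δ * (k / m) * ‖g‖ ^ 2 ≤ |f ω g - k / m * ‖g‖ ^ 2|
      rw [hfy, mul_comm (‖g‖ ^ 2), ← sub_mul, abs_mul, abs_of_nonneg (sq_nonneg ‖g‖)]
      gcongr
  have hle : Pr {ω | δ * (k / m) ≤ |f ω x - k / m|} ≤
      ENNReal.ofReal (4 * Real.exp (-(1 / 12800 * δ ^ 2 * k))) := by
    refine le_of_forall_le_section hS (fun g => ?_) hsec (h.2.1.mono fun ω hω => ?_)
    · have hfg := hfω g
      exact nullMeasurableSet_le (f := fun _ => δ * (k / m) * ‖g‖ ^ 2)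
        (g := fun ω => |f ω g - k / m * ‖g‖ ^ 2|) aemeasurable_const (hfg.sub_const _).abs
    · have hle := stdGaussian_ratio_toEuclideanLin_le hk hω hδ0 hδ1
      rw [measureReal_def] at hle
      exact (ENNReal.le_ofReal_iff_toReal_le (by finiteness) (by positivity)).2 hle
  exact ENNReal.toReal_le_of_le_ofReal (by positivity) hle

end UniformProjection

/-! ### Union bound over pairs of vectors -/

section UnionBound

variable {Ω : Type*} [MeasurableSpace Ω] {Pr : Measure Ω} [IsProbabilityMeasure Pr] {k m n : ℕ}

/-- Norm concentration holds for all four families of random matrices with the same constant. -/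
theorem IsRandomProjectionMatrix.normConcentration {P : Ω → Matrix (Fin k) (Fin m) ℝ}
    (h : IsRandomProjectionMatrix P Pr) (hk : 0 < k) : NormConcentration (1 / 12800) P Pr := by
  rcases h with h | h | h | h
  · exact h.normConcentration hk
  · exact h.normConcentration hk hasSubgaussianMGF_id_gaussianReal (by simp)
      integral_sq_gaussianReal (by norm_num) le_rfl
  · have h0 : ∫ y, y ∂signLaw = 0 := by simp [integral_signLaw]
    exact h.normConcentration hk (hasSubgaussianMGF_id_of_ae_mem_Icc ae_signLaw h0) h0
      (σ := 1) (by rw [integral_signLaw]; norm_num) (by norm_num) le_rfl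
  · have h0 : ∫ y, y ∂sparseLaw = 0 := by rw [integral_sparseLaw]; norm_num
    exact h.normConcentration hk (hasSubgaussianMGF_id_of_ae_mem_Icc ae_sparseLaw h0) h0
      (σ := 1 / 3) (by rw [integral_sparseLaw]; norm_num) le_rfl (by norm_num)

/-- Norm concentration and a union bound: all inner products in a finite family of unit vectors are
almost preserved with high probability. -/
theorem NormConcentration.exists_inner {c : ℝ} {P : Ω → Matrix (Fin k) (Fin m) ℝ}
    (h : NormConcentration c P Pr) (v : Fin n → EuclideanSpace ℝ (Fin m)) (hv : ∀ i, ‖v i‖ = 1)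
    {δ : ℝ} (hδ0 : 0 < δ) (hδ1 : δ ≤ 1) :
    ∃ N : ℝ, 0 < N ∧ Pr.real {ω | ¬ ∀ i j, |inner ℝ (Matrix.toEuclideanLin (P ω) (v i))
        (Matrix.toEuclideanLin (P ω) (v j)) - N * inner ℝ (v i) (v j)| ≤ δ * N} ≤
      8 * n ^ 2 * Real.exp (-(c * δ ^ 2 * k)) := by
  obtain ⟨N, hN, h⟩ := h
  refine ⟨N, hN, ?_⟩
  -- The strict inequality makes `bad 0` empty; `z = 0` does occur, as `v i - v i`.
  let bad : EuclideanSpace ℝ (Fin m) → Set Ω := fun z =>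
    {ω | δ * N * ‖z‖ ^ 2 < |‖Matrix.toEuclideanLin (P ω) z‖ ^ 2 - N * ‖z‖ ^ 2|}
  have hbad : ∀ z, Pr.real (bad z) ≤ 4 * Real.exp (-(c * δ ^ 2 * k)) := by
    intro z
    rcases eq_or_ne z 0 with rfl | hz
    · simp only [bad, map_zero, norm_zero]
      norm_num
      positivity
    · have hz0 : 0 < ‖z‖ := norm_pos_iff.2 hz
      set y := ‖z‖⁻¹ • z with hy
      have hy1 : ‖y‖ = 1 := by rw [hy, norm_smul, norm_inv, norm_norm, inv_mul_cancel₀ hz0.ne']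
      have hzy : z = ‖z‖ • y := by rw [hy, smul_smul, mul_inv_cancel₀ hz0.ne', one_smul]
      refine (measureReal_mono fun ω hω => ?_).trans (h y hy1 δ hδ0 hδ1)
      have hfy : ‖Matrix.toEuclideanLin (P ω) z‖ ^ 2 =
          ‖Matrix.toEuclideanLin (P ω) y‖ ^ 2 * ‖z‖ ^ 2 := by
        conv_lhs => rw [hzy]
        rw [map_smul, norm_smul, norm_norm, mul_pow, mul_comm]
      simp only [bad, Set.mem_ofPred_eq] at hω
      rw [hfy, ← sub_mul, abs_mul, abs_of_nonneg (sq_nonneg ‖z‖)] at hω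
      exact (lt_of_mul_lt_mul_right hω (sq_nonneg _)).le
  calc _ ≤ Pr.real (⋃ q : Fin n × Fin n, bad (v q.1 + v q.2) ∪ bad (v q.1 - v q.2)) := by
        refine measureReal_mono fun ω hω => ?_
        simp only [Set.mem_ofPred_eq, not_forall] at hω
        obtain ⟨i, j, hij⟩ := hω
        by_contra hnot
        simp only [Set.mem_iUnion, Set.mem_union, not_exists, not_or, bad, Set.mem_ofPred_eq,
          not_lt] at hnot
        refine hij (abs_inner_map_sub_le _ (hv i) (hv j) ?_)
        rintro z (rfl | rfl)
        · exact (hnot (i, j)).1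
        · exact (hnot (i, j)).2
    _ ≤ ∑ q : Fin n × Fin n, Pr.real (bad (v q.1 + v q.2) ∪ bad (v q.1 - v q.2)) :=
        measureReal_iUnion_fintype_le _
    _ ≤ ∑ _q : Fin n × Fin n, 8 * Real.exp (-(c * δ ^ 2 * k)) := by
        refine Finset.sum_le_sum fun q _ => (measureReal_union_le _ _).trans ?_
        linarith [hbad (v q.1 + v q.2), hbad (v q.1 - v q.2)]
    _ = _ := by simp; ring

theorem scaledMap_notMem_cone {s : ℝ} (hs : 0 < s) {M : Matrix (Fin k) (Fin m) ℝ}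
    {b : EuclideanSpace ℝ (Fin m)} {a : Fin n → EuclideanSpace ℝ (Fin m)}
    (h : Matrix.toEuclideanLin M b ∉ cone fun i => Matrix.toEuclideanLin M (a i)) :
    scaledMap s M b ∉ cone fun i => scaledMap s M (a i) := by
  rintro ⟨l, hl, hx⟩
  refine h ⟨l, hl, smul_right_injective _ hs.ne' ?_⟩
  simpa [scaledMap, Finset.smul_sum, smul_comm s] using hx

end UnionBound

/-- Since `n ≥ 1`, `4(n + 1)²q² ≤ (2n(n + 1)q)² ≤ 1`: two spare factors of `q` absorb the excess of
the union bound over the required prefactor. -/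
theorem eight_mul_pow_three_le {n q : ℝ} (hn : 1 ≤ n) (hq : 0 < q)
    (h : 2 * n * (n + 1) * q < 1) : 8 * (n + 1) ^ 2 * q ^ 3 ≤ 2 * n * (n + 1) * q := by
  have h1 : (2 * n * (n + 1) * q) ^ 2 ≤ 1 := pow_le_one₀ (by positivity) h.le
  have h2 : 4 * (n + 1) ^ 2 * q ^ 2 ≤ 1 := by
    refine le_trans ?_ h1
    have : 0 ≤ 4 * (n + 1) ^ 2 * q ^ 2 * (n ^ 2 - 1) := by
      have : 1 ≤ n ^ 2 := one_le_pow₀ hn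
      have : 0 ≤ n ^ 2 - 1 := by linarith
      positivity
    linarith
  have h3 : 8 * (n + 1) ^ 2 * q ^ 3 ≤ 2 * q := by
    have := mul_le_mul_of_nonneg_right h2 hq.le
    nlinarith
  have h4 : 1 * q ≤ n * (n + 1) * q := by
    gcongr
    nlinarith
  linarith

end RandProjCone

theorem mainTheorem1 :
    ∃ c : ℝ, 0 < c ∧
      ∀ (m n k : ℕ), 1 ≤ n →
      ∀ (b : EuclideanSpace ℝ (Fin m)) (a : Fin n → EuclideanSpace ℝ (Fin m)),
        ‖b‖ = 1 → (∀ i, ‖a i‖ = 1) → b ∉ RandProjCone.cone a →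
      ∀ (p : EuclideanSpace ℝ (Fin m)), RandProjCone.IsProjOn (RandProjCone.cone a) b p →
      ∀ (d ε : ℝ), d = Metric.infDist b (RandProjCone.cone a) →
        ε = d ^ 2 / (RandProjCone.muA a ^ 2 + 2 * ‖p‖ * RandProjCone.muA a + 1) →
      ∀ (Ω : Type*) [MeasurableSpace Ω] (Pr : Measure Ω) [IsProbabilityMeasure Pr]
        (P : Ω → Matrix (Fin k) (Fin m) ℝ) (s : ℝ),
        RandProjCone.IsRandomProjectionMatrix P Pr → 0 < s →
        1 - 2 * (n : ℝ) * ((n : ℝ) + 1) * Real.exp (-(c * (ε ^ 2 - ε ^ 3) * (k : ℝ))) ≤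
          Pr.real {ω | RandProjCone.scaledMap s (P ω) b ∉
            RandProjCone.cone (fun i => RandProjCone.scaledMap s (P ω) (a i))} := by
  refine ⟨1 / 153600, by norm_num, ?_⟩
  intro m n k hn b a hb ha hbC p hp d ε hd hε Ω _ Pr _ P s hP hs
  have hnR : (1 : ℝ) ≤ n := Nat.one_le_cast.2 hn
  have hμ := RandProjCone.muA_nonneg a
  have hdp : d = ‖b - p‖ := hd.trans hp.infDist_eq
  have hd0 : 0 < d := by
    rw [hdp]
    exact norm_pos_iff.2 (sub_ne_zero.2 fun h => hbC (h ▸ hp.1))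
  have hd1 : d ≤ 1 := by
    have := hp.2 0 (RandProjCone.zero_mem_cone a)
    rwa [sub_zero, hb, ← hdp] at this
  have hε0 : 0 < ε := by rw [hε]; positivity
  have hε1 : ε ≤ 1 := by
    rw [hε, div_le_one (by positivity)]
    have h1 : d ^ 2 ≤ 1 := pow_le_one₀ hd0.le hd1
    have h2 : 0 ≤ RandProjCone.muA a ^ 2 + 2 * ‖p‖ * RandProjCone.muA a := by positivity
    linarith
  set q := Real.exp (-(1 / 153600 * ε ^ 2 * k)) with hq
  have hq0 : 0 < q := Real.exp_pos _
  -- The argument gives the rate `ε²`; the cubic term is simply discarded.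
  have hle : q ≤ Real.exp (-(1 / 153600 * (ε ^ 2 - ε ^ 3) * (k : ℝ))) := by
    rw [hq]
    gcongr
    have : 0 < ε ^ 3 := by positivity
    linarith
  refine (sub_le_sub_left (mul_le_mul_of_nonneg_left hle (by positivity)) 1).trans ?_
  -- If the failure bound is at least `1` there is nothing to prove; this also disposes of `k = 0`,
  -- where `q = 1`.
  rcases le_or_gt 1 (2 * n * (n + 1) * q) with hbig | hsmall
  · exact (sub_nonpos.2 hbig).trans measureReal_nonneg
  have hk : 0 < k := by
    rcases Nat.eq_zero_or_pos k with rfl | hk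
    · have hq1 : q = 1 := by simp [hq]
      rw [hq1] at hsmall
      nlinarith
    · exact hk
  -- Separation needs `δ < ε` strictly; `δ = ε/2` costs a factor `4` in the rate.
  obtain ⟨N, hN, hbad⟩ := (hP.normConcentration hk).exists_inner
    (Fin.cons b a : Fin (n + 1) → EuclideanSpace ℝ (Fin m))
    (Fin.cases hb ha) (δ := ε / 2) (by positivity) (by linarith)
  -- `153600 = 3 * 4 * 12800`: the `3` produces the cube.
  have hq3 : Real.exp (-(1 / 12800 * (ε / 2) ^ 2 * k)) = q ^ 3 := by
    rw [hq, ← Real.exp_nat_mul]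
    congr 1
    push_cast
    ring
  rw [hq3] at hbad
  push_cast at hbad
  set G := {ω | RandProjCone.scaledMap s (P ω) b ∉
    RandProjCone.cone (fun i => RandProjCone.scaledMap s (P ω) (a i))} with hG
  -- Subadditivity suffices here, so measurability of `G` is not needed.
  have hone : 1 ≤ Pr.real G + Pr.real Gᶜ := by
    have := measureReal_union_le (μ := Pr) G Gᶜ
    rwa [Set.union_compl_self, probReal_univ] at this
  have hGc : Pr.real Gᶜ ≤ 8 * ((n : ℝ) + 1) ^ 2 * q ^ 3 := by
    refine le_trans (measureReal_mono ?_) hbad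
    intro ω hω
    rw [Set.mem_ofPred_eq]
    refine fun hgood => hω ?_
    refine RandProjCone.scaledMap_notMem_cone hs ?_
    refine RandProjCone.map_notMem_cone hp hb hbC (δ := ε / 2) (by positivity) ?_ _ hN hgood
    rw [← hdp, ← hε]
    linarith
  linarith [RandProjCone.eight_mul_pow_three_le hnR hq0 hsmall]
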